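/- Let $n\ge 0$ be an integer and equip $\mathbb{R}^n$ with the product order ($x\le y$ if $x_i\le y_i$ for all $i$). A map $f:\mathbb{R}^n\to\mathbb{R}^n$ is called monotone if $x\le y$ implies $f(x)\le f(y)$; (additively) homogeneous if $f(\lambda+x)=\lambda+f(x)$ for all $\lambda\in\mathbb{R}$ and $x\in\mathbb{R}^n$, where $\lambda+x=(\lambda+x_1,\ldots,\lambda+x_n)$; and convex if each of its coordinate functions is convex. A periodic orbit of $f$ is a set $\{f^k(x) : k\in\mathbb{N}\}$ where $x\in\mathbb{R}^n$ satisfies $f^c(x)=x$ for some integer $c\ge 1$; its length is the least such $c$. Then the set of all lengths of periodic orbits of convex monotone homogeneous maps $\mathbb{R}^n\to\mathbb{R}^n$ is exactly the set of orders of elements of the symmetric group on $n$ letters. -/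

import Mathlib

/-- Additive homogeneity of `f : ℝⁿ → ℝⁿ`: `f` commutes with the addition of constants. -/
def AdditivelyHomogeneous {n : ℕ} (f : (Fin n → ℝ) → (Fin n → ℝ)) : Prop :=
  ∀ (a : ℝ) (x : Fin n → ℝ), f (fun i => a + x i) = fun i => a + f x i

/-- Convex monotone (additively) homogeneous self-maps of `ℝⁿ`. The order on `Fin n → ℝ` is the
product order, so convexity means convexity of every coordinate function. -/
structure IsConvexMonotoneHomogeneous {n : ℕ} (f : (Fin n → ℝ) → (Fin n → ℝ)) : Prop where
  convex : ConvexOn ℝ Set.univ f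
  monotone : Monotone f
  homogeneous : AdditivelyHomogeneous f

/-- `c` is the length of a periodic orbit of `f`: some point `x` satisfies `f^k(x) = x` for some
`k ≥ 1`, and `c` is the least such `k`. -/
def IsPeriodicOrbitLength {α : Type*} (f : α → α) (c : ℕ) : Prop :=
  ∃ x ∈ Function.periodicPts f, Function.minimalPeriod f x = c

/-!
Let `x` be a periodic orbit of `f`, indexed by the cyclic group `ZMod c`. A subgradient of the
coordinates of `f` at `x k` is a row-stochastic matrix `P k`, and convexity says that every
increment `x (k + a) - x k` is superharmonic for the Markov chain which moves from time `k + 1` to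
time `k` with transition matrix `P k`. On a minimal closed class of this chain all the increments
are constant. Hence the coordinate sequences visited by such a class are, up to translation and
additive constants, one and the same sequence, and they have the same period `q`; as such a class
meets every time, it visits at least `q` different coordinates. By the minimum principle, a common
period of the coordinates visited by minimal closed classes is a period of the whole orbit. So `c`
is a least common multiple of distinct integers with sum at most `n`, that is, the order of a
permutation. Conversely, a permutation of the coordinates is itself a convex monotone homogeneous
map, and its orbit through a point with distinct coordinates has the order of the permutation as
its length.
-/

open Function Set Matrix
open scoped Topology

section Subgradient

theorem exists_subgradient {E : Type*} [AddCommGroup E] [Module ℝ E] [TopologicalSpace E]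
    [IsTopologicalAddGroup E] [ContinuousSMul ℝ E] {g : E → ℝ} (hg : ConvexOn ℝ univ g)
    (hcont : Continuous g) (x : E) : ∃ l : StrongDual ℝ E, ∀ y, l (y - x) ≤ g y - g x := by
  have hopen : IsOpen {p : E × ℝ | p.1 ∈ univ ∧ g p.1 < p.2} := by
    simpa using isOpen_lt (hcont.comp continuous_fst) continuous_snd
  obtain ⟨φ, hφ⟩ := geometric_hahn_banach_point_open hg.convex_strict_epigraph hopen
    (x := (x, g x)) (by simp)
  have hsplit (y : E) (t : ℝ) : φ (y, t) = φ (y, 0) + t * φ (0, 1) := by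
    rw [← smul_eq_mul, ← map_smul, ← map_add]
    simp
  have hpos : 0 < φ (0, 1) := by
    have h := hφ (x, g x + 1) (by simp)
    rw [hsplit x (g x), hsplit x (g x + 1)] at h
    linarith
  have hgraph (y : E) : φ (x, g x) ≤ φ (y, g y) := by
    have hlim : Filter.Tendsto (fun t => φ (y, t)) (𝓝[>] g y) (𝓝 (φ (y, g y))) :=
      (by fun_prop : Continuous fun t => φ (y, t)).continuousWithinAt
    exact ge_of_tendsto hlim
      (eventually_mem_nhdsWithin.mono fun t ht => (hφ (y, t) ⟨trivial, ht⟩).le)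
  refine ⟨-(φ (0, 1))⁻¹ • φ.comp (ContinuousLinearMap.inl ℝ E ℝ), fun y => ?_⟩
  have hsub : φ (y - x, 0) = φ (y, 0) - φ (x, 0) := by
    rw [← map_sub]
    simp
  have hle : -φ (y - x, 0) ≤ (g y - g x) * φ (0, 1) := by
    have h := hgraph y
    rw [hsplit x, hsplit y] at h
    linarith
  calc -(φ (0, 1))⁻¹ * φ (y - x, 0) = -φ (y - x, 0) / φ (0, 1) := by ring
    _ ≤ g y - g x := (div_le_iff₀ hpos).2 hle

theorem exists_mem_stdSimplex_subgradient {ι : Type*} [Fintype ι] {g : (ι → ℝ) → ℝ}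
    (hconvex : ConvexOn ℝ univ g) (hmono : Monotone g)
    (hhom : ∀ (a : ℝ) (y : ι → ℝ), g (fun i => a + y i) = a + g y) (x : ι → ℝ) :
    ∃ p ∈ stdSimplex ℝ ι, ∀ y, p ⬝ᵥ (y - x) ≤ g y - g x := by
  classical
  obtain ⟨l, hl⟩ := exists_subgradient hconvex hconvex.locallyLipschitz.continuous x
  obtain ⟨p, hp⟩ := (dotProductEquiv ℝ ι).surjective l.toLinearMap
  have hsubgrad (y : ι → ℝ) : p ⬝ᵥ (y - x) ≤ g y - g x := by
    simpa [← hp] using (LinearMap.congr_fun hp (y - x)).trans_le (hl y)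
  have hconst (a : ℝ) : a * ∑ i, p i ≤ a := by
    have h := hsubgrad fun i => a + x i
    rw [hhom, add_sub_cancel_right, show (fun i => a + x i) - x = fun _ => a by ext; simp] at h
    simpa [dotProduct, ← Finset.sum_mul, mul_comm a] using h
  refine ⟨p, ⟨fun i => ?_, ?_⟩, hsubgrad⟩
  · have h := hsubgrad (x - Pi.single i 1)
    have hle : g (x - Pi.single i 1) ≤ g x :=
      hmono (sub_le_self x (Pi.single_nonneg.2 zero_le_one))
    rw [sub_sub_cancel_left, dotProduct_neg, dotProduct_single_one] at h
    linarith
  · linarith [hconst 1, hconst (-1)]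

theorem IsConvexMonotoneHomogeneous.exists_rowStochastic_subgradient {n : ℕ}
    {f : (Fin n → ℝ) → (Fin n → ℝ)} (hf : IsConvexMonotoneHomogeneous f) (x : Fin n → ℝ) :
    ∃ P ∈ rowStochastic ℝ (Fin n), ∀ y, P *ᵥ (y - x) ≤ f y - f x := by
  have hcoord (i : Fin n) : ConvexOn ℝ univ fun y => f y i :=
    ⟨convex_univ, fun _ hy _ hz _ _ ha hb hab => hf.convex.2 hy hz ha hb hab i⟩
  choose P hP hle using fun i => exists_mem_stdSimplex_subgradient (hcoord i)
    (fun _ _ h => hf.monotone h i) (fun a y => congrFun (hf.homogeneous a y) i) x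
  exact ⟨of P, mem_rowStochastic_iff_sum.2 ⟨fun i => (hP i).1, fun i => (hP i).2⟩,
    fun y i => hle i y⟩

end Subgradient

section Superharmonic

/-- A set of states of the Markov chain with transition matrix `Q` is a *closed class* if the chain
cannot leave it: it is closed under the transitions of positive weight. -/
def IsClosedClass {S R : Type*} [Zero R] [LT R] (Q : Matrix S S R) (C : Set S) : Prop :=
  ∀ s ∈ C, ∀ t, 0 < Q s t → t ∈ C

/-- A *final class* of the Markov chain with transition matrix `Q` is a minimal nonempty closed
class. -/
def IsFinalClass {S R : Type*} [Zero R] [LT R] (Q : Matrix S S R) (C : Set S) : Prop :=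
  Minimal (fun D => D.Nonempty ∧ IsClosedClass Q D) C

theorem IsClosedClass.exists_isFinalClass_subset {S R : Type*} [Finite S] [Zero R] [LT R]
    {Q : Matrix S S R} {C : Set S} (hC : IsClosedClass Q C) (hne : C.Nonempty) :
    ∃ D ⊆ C, IsFinalClass Q D :=
  (toFinite {D : Set S | D.Nonempty ∧ IsClosedClass Q D}).exists_le_minimal ⟨hne, hC⟩

variable {S R : Type*} [Fintype S] [DecidableEq S] [Ring R] [LinearOrder R] [IsStrictOrderedRing R]
  {Q : Matrix S S R} {C : Set S} {d : S → R}

theorem exists_pos_of_mem_rowStochastic (hQ : Q ∈ rowStochastic R S) (s : S) : ∃ t, 0 < Q s t := by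
  obtain ⟨t, -, ht⟩ := Finset.exists_lt_of_sum_lt (s := Finset.univ) (f := fun _ => (0 : R))
    (g := Q s) (by simp [sum_row_of_mem_rowStochastic hQ])
  exact ⟨t, ht⟩

-- The value at a minimizer dominates a weighted mean of values which are at least as large.
theorem IsClosedClass.setOf_isMinOn (hC : IsClosedClass Q C) (hQ : Q ∈ rowStochastic R S)
    (hd : Q *ᵥ d ≤ d) : IsClosedClass Q {s ∈ C | IsMinOn d C s} := by
  rintro s ⟨hs, hmin⟩ t hst
  have hterm : ∀ u ∈ Finset.univ, 0 ≤ Q s u * (d u - d s) := fun u _ => by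
    rcases (nonneg_of_mem_rowStochastic hQ : 0 ≤ Q s u).eq_or_lt with h | h
    · simp [← h]
    · exact mul_nonneg h.le (sub_nonneg.2 (hmin (hC s hs u h)))
  have hsum : ∑ u, Q s u * (d u - d s) ≤ 0 := by
    rw [Finset.sum_congr rfl fun u _ => mul_sub (Q s u) (d u) (d s), Finset.sum_sub_distrib,
      ← Finset.sum_mul, sum_row_of_mem_rowStochastic hQ, one_mul, sub_nonpos]
    exact hd s
  have hzero : Q s t * (d t - d s) = 0 :=
    (Finset.sum_eq_zero_iff_of_nonneg hterm).1 (hsum.antisymm (Finset.sum_nonneg hterm)) t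
      (Finset.mem_univ t)
  have heq : d t = d s := sub_eq_zero.1 ((mul_eq_zero.1 hzero).resolve_left hst.ne')
  exact ⟨hC s hs t hst, fun u hu => heq.trans_le (hmin hu)⟩

theorem IsFinalClass.isMinOn (hC : IsFinalClass Q C) (hQ : Q ∈ rowStochastic R S)
    (hd : Q *ᵥ d ≤ d) {s : S} (hs : s ∈ C) : IsMinOn d C s := by
  obtain ⟨t, ht, hmin⟩ := exists_min_image C d C.toFinite hC.prop.1
  have hle : C ≤ {u ∈ C | IsMinOn d C u} :=
    hC.le_of_le ⟨⟨t, ht, hmin⟩, hC.prop.2.setOf_isMinOn hQ hd⟩ fun _ h => h.1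
  exact (hle hs).2

theorem IsFinalClass.apply_eq (hC : IsFinalClass Q C) (hQ : Q ∈ rowStochastic R S)
    (hd : Q *ᵥ d ≤ d) {s t : S} (hs : s ∈ C) (ht : t ∈ C) : d s = d t :=
  (hC.isMinOn hQ hd hs ht).antisymm (hC.isMinOn hQ hd ht hs)

theorem exists_isFinalClass_forall_isMinOn [Nonempty S] (hQ : Q ∈ rowStochastic R S)
    (hd : Q *ᵥ d ≤ d) : ∃ C, IsFinalClass Q C ∧ ∀ s ∈ C, IsMinOn d univ s := by
  obtain ⟨s, hs, hmin⟩ := exists_min_image univ d finite_univ univ_nonempty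
  have huniv : IsClosedClass Q univ := fun _ _ _ _ => mem_univ _
  obtain ⟨C, hsub, hC⟩ := (huniv.setOf_isMinOn hQ hd).exists_isFinalClass_subset ⟨s, hs, hmin⟩
  exact ⟨C, hC, fun t ht => (hsub ht).2⟩

end Superharmonic

section Periods

/-- The subgroup of the periods of a function on an additive group. -/
def periodSubgroup {A β : Type*} [AddGroup A] (s : A → β) : AddSubgroup A where
  carrier := {a | Periodic s a}
  zero_mem' k := by rw [add_zero]
  add_mem' ha hb := ha.add_period hb
  neg_mem' ha := ha.neg

theorem mem_periodSubgroup {A β : Type*} [AddGroup A] {s : A → β} {a : A} :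
    a ∈ periodSubgroup s ↔ Periodic s a :=
  Iff.rfl

theorem periodic_of_le_add {A β : Type*} [AddGroup A] [Finite A] [AddCommMonoid β] [PartialOrder β]
    [IsOrderedCancelAddMonoid β] {s : A → β} {a : A} (h : ∀ k, s k ≤ s (k + a)) :
    Periodic s a := by
  have := Fintype.ofFinite A
  have hsum : ∑ k, s k = ∑ k, s (k + a) := (Equiv.sum_comp (Equiv.addRight a) s).symm
  exact fun k => ((Finset.sum_eq_sum_iff_of_le fun k _ => h k).1 hsum k (Finset.mem_univ k)).symm

section Increments

variable {A β : Type*} [AddCommGroup A] [AddCommGroup β]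

theorem periodSubgroup_le_of_sub_eq_sub {s t : A → β} {k l : A}
    (h : ∀ a, s (k + a) - s k = t (l + a) - t l) : periodSubgroup s ≤ periodSubgroup t := by
  have ht (m : A) : t m = s (m + (k - l)) + (t l - s k) := by
    have hm := h (m - l)
    rw [add_sub_cancel, add_sub_left_comm] at hm
    rw [eq_add_of_sub_eq hm.symm]
    abel
  intro a ha m
  rw [ht (m + a), ht m, add_right_comm, mem_periodSubgroup.1 ha]

theorem periodSubgroup_eq_of_sub_eq_sub {s t : A → β} {k l : A}
    (h : ∀ a, s (k + a) - s k = t (l + a) - t l) : periodSubgroup s = periodSubgroup t :=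
  (periodSubgroup_le_of_sub_eq_sub h).antisymm (periodSubgroup_le_of_sub_eq_sub fun a => (h a).symm)

theorem periodic_of_sub_eq_sub [Finite A] [LinearOrder β] [IsOrderedAddMonoid β] {s : A → β}
    {k l : A} (h : ∀ a, s (k + a) - s k = s (l + a) - s l) : Periodic s (l - k) := by
  have hshift (m : A) : s (m + (l - k)) = s m + (s l - s k) := by
    have hm := h (m - k)
    rw [add_sub_cancel, add_sub_left_comm] at hm
    rw [eq_add_of_sub_eq hm.symm]
    abel
  rcases le_total 0 (s l - s k) with hnonneg | hnonpos
  · exact periodic_of_le_add fun m => by simpa [hshift] using hnonneg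
  · exact periodic_of_le_add (β := βᵒᵈ) fun m =>
      ((hshift m).trans_le (add_le_of_nonpos_right hnonpos) : s (m + (l - k)) ≤ s m)

end Increments

theorem index_le_card_of_neg_add_mem {A ι : Type*} [AddGroup A] {H : AddSubgroup A} {T : Finset ι}
    (φ : A → ι) (hφT : ∀ a, φ a ∈ T) (hφ : ∀ a b, φ a = φ b → -a + b ∈ H) : H.index ≤ T.card := by
  rw [H.index_eq_card, ← Nat.card_eq_finsetCard]
  refine Nat.card_le_card_of_injective (fun q : A ⧸ H => (⟨φ q.out, hφT _⟩ : T)) fun q r hqr => ?_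
  rw [← q.out_eq', ← r.out_eq']
  exact QuotientAddGroup.eq.2 (hφ _ _ (congrArg Subtype.val hqr))

theorem nsmul_mem_of_index_dvd {A : Type*} [AddCommGroup A] {H : AddSubgroup A} {m : ℕ}
    (h : H.index ∣ m) (a : A) : m • a ∈ H := by
  obtain ⟨k, rfl⟩ := h
  rw [mul_nsmul]
  exact H.nsmul_mem (H.nsmul_index_mem a) k

end Periods

section SpaceTime

variable {c : ℕ} {ι R : Type*}

/-- The transition matrix on pairs (time, state) of the Markov chain which moves from time `k + 1`
to time `k` with transition matrix `P k`. Time runs backwards because row `i` of `P k` is a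
subgradient of the map that produces the `i`-th coordinate at time `k + 1` from time `k`. -/
def spaceTimeMatrix [Zero R] (P : ZMod c → Matrix ι ι R) :
    Matrix (ZMod c × ι) (ZMod c × ι) R :=
  of fun s t => if t.1 + 1 = s.1 then P t.1 s.2 t.2 else 0

/-- The increments over a time step `a` of the coordinates of `x`, as a function on pairs
(time, coordinate). -/
def increment [Sub R] (x : ZMod c → ι → R) (a : ZMod c) : ZMod c × ι → R :=
  fun s => x (s.1 + a) s.2 - x s.1 s.2

/-- The coordinates of `x` whose least period is at most the number of coordinates with the same
least period. The least period of a function on `ZMod c` is encoded as the index of its subgroup of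
periods. -/
noncomputable def abundantCoordinates [Fintype ι] (x : ZMod c → ι → R) : Finset ι :=
  {i | (periodSubgroup (x · i)).index ≤
    Finset.card {j | (periodSubgroup (x · j)).index = (periodSubgroup (x · i)).index}}

variable [NeZero c] [Fintype ι]

theorem spaceTimeMatrix_mulVec_apply [NonUnitalNonAssocSemiring R] (P : ZMod c → Matrix ι ι R)
    (d : ZMod c × ι → R) (k : ZMod c) (i : ι) :
    (spaceTimeMatrix P *ᵥ d) (k + 1, i) = (P k *ᵥ fun j => d (k, j)) i := by
  simp only [mulVec, dotProduct, spaceTimeMatrix, of_apply, add_left_inj, ite_mul, zero_mul,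
    Fintype.sum_prod_type_right, Finset.sum_ite_eq', Finset.mem_univ, if_true]

theorem spaceTimeMatrix_mulVec_increment_le [NonUnitalNonAssocRing R] [LE R]
    {P : ZMod c → Matrix ι ι R} {x : ZMod c → ι → R}
    (hx : ∀ k l, P k *ᵥ (x l - x k) ≤ x (l + 1) - x (k + 1)) (a : ZMod c) :
    spaceTimeMatrix P *ᵥ increment x a ≤ increment x a := by
  rintro ⟨k, i⟩
  obtain ⟨k, rfl⟩ : ∃ l, l + 1 = k := ⟨k - 1, sub_add_cancel k 1⟩
  rw [spaceTimeMatrix_mulVec_apply]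
  calc (P k *ᵥ fun j => increment x a (k, j)) i ≤ x (k + a + 1) i - x (k + 1) i := hx k (k + a) i
    _ = increment x a (k + 1, i) := by rw [increment, add_right_comm]

variable [DecidableEq ι] [Ring R] [LinearOrder R] [IsStrictOrderedRing R]
  {P : ZMod c → Matrix ι ι R} {x : ZMod c → ι → R} {C : Set (ZMod c × ι)}

theorem spaceTimeMatrix_mem_rowStochastic (hP : ∀ k, P k ∈ rowStochastic R ι) :
    spaceTimeMatrix P ∈ rowStochastic R (ZMod c × ι) := by
  refine ⟨fun s t => ?_, ?_⟩
  · rw [spaceTimeMatrix, of_apply]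
    split_ifs
    exacts [nonneg_of_mem_rowStochastic (hP _), le_rfl]
  · ext ⟨k, i⟩
    rw [← sub_add_cancel k 1, spaceTimeMatrix_mulVec_apply]
    exact congrFun (hP _).2 i

theorem IsClosedClass.exists_mem_of_time (hC : IsClosedClass (spaceTimeMatrix P) C)
    (hne : C.Nonempty) (hP : ∀ k, P k ∈ rowStochastic R ι) (k : ZMod c) : ∃ i, (k, i) ∈ C := by
  have hstep (l : ZMod c) : (∃ i, (l + 1, i) ∈ C) → ∃ i, (l, i) ∈ C := by
    rintro ⟨i, hi⟩
    obtain ⟨j, hj⟩ := exists_pos_of_mem_rowStochastic (hP l) i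
    exact ⟨j, hC _ hi _ (by simpa [spaceTimeMatrix] using hj)⟩
  obtain ⟨⟨l, i⟩, hli⟩ := hne
  have hback (m : ℕ) : ∃ j, (l - m, j) ∈ C := by
    induction m with
    | zero => exact ⟨i, by simpa using hli⟩
    | succ m ih => exact hstep _ (by simpa [sub_add_eq_sub_sub] using ih)
  simpa using hback (l - k).val

theorem IsFinalClass.snd_mem_abundantCoordinates (hC : IsFinalClass (spaceTimeMatrix P) C)
    (hP : ∀ k, P k ∈ rowStochastic R ι) (hx : ∀ k l, P k *ᵥ (x l - x k) ≤ x (l + 1) - x (k + 1))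
    {s : ZMod c × ι} (hs : s ∈ C) : s.2 ∈ abundantCoordinates x := by
  have hincr (a : ZMod c) {t u : ZMod c × ι} (ht : t ∈ C) (hu : u ∈ C) :
      x (t.1 + a) t.2 - x t.1 t.2 = x (u.1 + a) u.2 - x u.1 u.2 :=
    hC.apply_eq (spaceTimeMatrix_mem_rowStochastic hP) (spaceTimeMatrix_mulVec_increment_le hx a)
      ht hu
  choose φ hφ using hC.prop.2.exists_mem_of_time hC.prop.1 hP
  have hperiods (k : ZMod c) : periodSubgroup (x · (φ k)) = periodSubgroup (x · s.2) :=
    periodSubgroup_eq_of_sub_eq_sub fun a => hincr a (hφ k) hs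
  refine Finset.mem_filter.2 ⟨Finset.mem_univ _, index_le_card_of_neg_add_mem φ (fun k => ?_)
    fun k l hkl => ?_⟩
  · simp [hperiods]
  · rw [neg_add_eq_sub, ← hperiods k]
    refine periodic_of_sub_eq_sub (s := (x · (φ k))) fun a => ?_
    simpa only [← hkl] using hincr a (hφ k) (hφ l)

theorem periodic_of_forall_mem_abundantCoordinates (hP : ∀ k, P k ∈ rowStochastic R ι)
    (hx : ∀ k l, P k *ᵥ (x l - x k) ≤ x (l + 1) - x (k + 1)) {a : ZMod c}
    (ha : ∀ i ∈ abundantCoordinates x, Periodic (x · i) a) : Periodic x a := by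
  have hnonneg (s : ZMod c × ι) : 0 ≤ increment x a s := by
    have : Nonempty (ZMod c × ι) := ⟨s⟩
    obtain ⟨C, hC, hmin⟩ := exists_isFinalClass_forall_isMinOn
      (spaceTimeMatrix_mem_rowStochastic hP) (spaceTimeMatrix_mulVec_increment_le hx a)
    obtain ⟨t, ht⟩ := hC.prop.1
    have hzero : increment x a t = 0 :=
      sub_eq_zero.2 (ha t.2 (hC.snd_mem_abundantCoordinates hP hx ht) t.1)
    exact hzero.symm.trans_le (hmin t ht (mem_univ s))
  intro k
  ext i
  exact periodic_of_le_add (s := (x · i)) (fun l => sub_nonneg.1 (hnonneg (l, i))) k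

end SpaceTime

section CyclicOrbit

variable {α : Type*} {f : α → α} {x₀ : α}

/-- The orbit of `x₀` under `f`, indexed by the integers modulo its length. -/
noncomputable def cyclicOrbit (f : α → α) (x₀ : α) : ZMod (minimalPeriod f x₀) → α :=
  fun k => f^[k.val] x₀

theorem cyclicOrbit_natCast (m : ℕ) : cyclicOrbit f x₀ m = f^[m] x₀ := by
  rw [cyclicOrbit, ZMod.val_natCast, iterate_mod_minimalPeriod_eq]

theorem cyclicOrbit_add_one [NeZero (minimalPeriod f x₀)] (k : ZMod (minimalPeriod f x₀)) :
    cyclicOrbit f x₀ (k + 1) = f (cyclicOrbit f x₀ k) := by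
  obtain ⟨m, rfl⟩ := ZMod.natCast_zmod_surjective k
  rw [← Nat.cast_succ, cyclicOrbit_natCast, cyclicOrbit_natCast, iterate_succ_apply']

theorem minimalPeriod_dvd_of_periodic_cyclicOrbit {m : ℕ}
    (h : Periodic (cyclicOrbit f x₀) (m : ZMod (minimalPeriod f x₀))) :
    minimalPeriod f x₀ ∣ m := by
  refine IsPeriodicPt.minimalPeriod_dvd ?_
  calc f^[m] x₀ = cyclicOrbit f x₀ m := (cyclicOrbit_natCast m).symm
    _ = cyclicOrbit f x₀ (0 : ℕ) := by rw [h.eq, Nat.cast_zero]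
    _ = x₀ := cyclicOrbit_natCast 0

end CyclicOrbit

theorem IsConvexMonotoneHomogeneous.minimalPeriod_eq_lcm {n : ℕ} {f : (Fin n → ℝ) → (Fin n → ℝ)}
    (hf : IsConvexMonotoneHomogeneous f) {x₀ : Fin n → ℝ} (hx₀ : x₀ ∈ periodicPts f) :
    minimalPeriod f x₀ = (abundantCoordinates (cyclicOrbit f x₀)).lcm
      fun i => (periodSubgroup (cyclicOrbit f x₀ · i)).index := by
  have : NeZero (minimalPeriod f x₀) := ⟨(minimalPeriod_pos_of_mem_periodicPts hx₀).ne'⟩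
  choose P hP hle using fun k => hf.exists_rowStochastic_subgradient (cyclicOrbit f x₀ k)
  refine Nat.dvd_antisymm ?_ (Finset.lcm_dvd fun i _ => ?_)
  · refine minimalPeriod_dvd_of_periodic_cyclicOrbit
      (periodic_of_forall_mem_abundantCoordinates hP (fun k l => ?_) fun i hi => ?_)
    · simpa only [cyclicOrbit_add_one] using hle k (cyclicOrbit f x₀ l)
    · rw [← mem_periodSubgroup, ← nsmul_one (A := ZMod _)]
      exact nsmul_mem_of_index_dvd
        (Finset.dvd_lcm (f := fun i => (periodSubgroup (cyclicOrbit f x₀ · i)).index) hi) 1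
  · simpa using (periodSubgroup (cyclicOrbit f x₀ · i)).index_dvd_card

section Permutations

variable {α : Type*}

theorem exists_perm_orderOf_eq_lcm_of_sum_le [Fintype α] {m : Multiset ℕ} (hzero : 0 ∉ m)
    (hsum : m.sum ≤ Fintype.card α) : ∃ σ : Equiv.Perm α, orderOf σ = m.lcm := by
  classical
  have hfilter : (m.filter (2 ≤ ·)).sum ≤ m.sum := by
    conv_rhs => rw [← Multiset.filter_add_not (2 ≤ ·) m, Multiset.sum_add]
    exact Nat.le_add_right _ _
  obtain ⟨σ, hσ⟩ := (Equiv.Perm.exists_with_cycleType_iff α (m := m.filter (2 ≤ ·))).2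
    ⟨hfilter.trans hsum, fun _ ha => (Multiset.mem_filter.1 ha).2⟩
  refine ⟨σ, ?_⟩
  rw [← σ.lcm_cycleType, hσ]
  refine Nat.dvd_antisymm (Multiset.lcm_mono (m.filter_subset _))
    (Multiset.lcm_dvd.2 fun q hq => ?_)
  rcases lt_or_ge q 2 with hlt | hge
  · have hne : q ≠ 0 := ne_of_mem_of_not_mem hq hzero
    rw [show q = 1 by omega]
    exact one_dvd _
  · exact Multiset.dvd_lcm (Multiset.mem_filter.2 ⟨hq, hge⟩)

theorem exists_perm_orderOf_eq_lcm_of_le_card_fiber [Fintype α] {p : α → ℕ}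
    {J : Finset α} (hp : ∀ i ∈ J, p i ≠ 0) (hJ : ∀ i ∈ J, p i ≤ Finset.card {j | p j = p i}) :
    ∃ σ : Equiv.Perm α, orderOf σ = J.lcm p := by
  classical
  have hzero : 0 ∉ (J.image p).val := by simpa using hp
  have hsum : ∑ q ∈ J.image p, q ≤ Fintype.card α := by
    calc ∑ q ∈ J.image p, q ≤ ∑ q ∈ J.image p, Finset.card {j | p j = q} :=
          Finset.sum_le_sum (Finset.forall_mem_image.2 hJ)
      _ = Finset.card {j | p j ∈ J.image p} := Finset.sum_card_fiberwise_eq_card_filter _ _ _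
      _ ≤ Fintype.card α := Finset.card_le_univ _
  obtain ⟨σ, hσ⟩ := exists_perm_orderOf_eq_lcm_of_sum_le hzero
    (by simpa only [Finset.sum, Multiset.map_id'] using hsum)
  exact ⟨σ, by rw [hσ, Finset.lcm_eq_lcm_image, Finset.lcm_def, Multiset.map_id]⟩

theorem minimalPeriod_comp_perm {β : Type*} (σ : Equiv.Perm α) {x : α → β} (hx : Injective x) :
    minimalPeriod (fun y : α → β => y ∘ σ) x = orderOf σ := by
  have hiter (k : ℕ) : (fun y : α → β => y ∘ σ)^[k] x = x ∘ ⇑(σ ^ k) := by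
    induction k with
    | zero => rfl
    | succ k ih => rw [iterate_succ_apply', ih, pow_succ]; rfl
  refine Nat.dvd_right_iff_eq.1 fun k => ?_
  rw [← isPeriodicPt_iff_minimalPeriod_dvd, orderOf_dvd_iff_pow_eq_one, IsPeriodicPt, IsFixedPt,
    hiter, hx.comp_left.eq_iff' (comp_id x), ← Equiv.Perm.coe_one, DFunLike.coe_fn_eq]

end Permutations

theorem IsConvexMonotoneHomogeneous.exists_perm_orderOf_eq_minimalPeriod {n : ℕ}
    {f : (Fin n → ℝ) → (Fin n → ℝ)} (hf : IsConvexMonotoneHomogeneous f) {x₀ : Fin n → ℝ}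
    (hx₀ : x₀ ∈ periodicPts f) : ∃ σ : Equiv.Perm (Fin n), orderOf σ = minimalPeriod f x₀ := by
  have : NeZero (minimalPeriod f x₀) := ⟨(minimalPeriod_pos_of_mem_periodicPts hx₀).ne'⟩
  rw [hf.minimalPeriod_eq_lcm hx₀]
  exact exists_perm_orderOf_eq_lcm_of_le_card_fiber
    (fun i _ => AddSubgroup.index_ne_zero_of_finite) fun i hi => (Finset.mem_filter.1 hi).2

theorem isConvexMonotoneHomogeneous_comp {n : ℕ} (τ : Fin n → Fin n) :
    IsConvexMonotoneHomogeneous fun x : Fin n → ℝ => x ∘ τ where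
  convex := ⟨convex_univ, fun _ _ _ _ _ _ _ _ _ => le_rfl⟩
  monotone _ _ h i := h (τ i)
  homogeneous _ _ := rfl

theorem isPeriodicOrbitLength_comp_perm {n : ℕ} (σ : Equiv.Perm (Fin n)) :
    IsPeriodicOrbitLength (fun x : Fin n → ℝ => x ∘ σ) (orderOf σ) := by
  have hperiod := minimalPeriod_comp_perm σ (Nat.cast_injective.comp Fin.val_injective :
    Injective ((↑) ∘ Fin.val : Fin n → ℝ))
  exact ⟨_, minimalPeriod_pos_iff_mem_periodicPts.1 (hperiod ▸ orderOf_pos σ), hperiod⟩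

theorem mainTheorem3 (n : ℕ) :
    {c : ℕ | ∃ f : (Fin n → ℝ) → (Fin n → ℝ),
      IsConvexMonotoneHomogeneous f ∧ IsPeriodicOrbitLength f c} =
    {c : ℕ | ∃ σ : Equiv.Perm (Fin n), orderOf σ = c} := by
  ext c
  constructor
  · rintro ⟨f, hf, x, hx, rfl⟩
    exact hf.exists_perm_orderOf_eq_minimalPeriod hx
  · rintro ⟨σ, rfl⟩
    exact ⟨_, isConvexMonotoneHomogeneous_comp σ, isPeriodicOrbitLength_comp_perm σ⟩
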